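/- Let $X$ be a countably infinite set and let $X^*$ be the standard $X$-regular rooted tree: its vertices are the finite words in $X$, its root is the empty word, and its edges are the pairs $(v,vx)$ with $v\in X^*$, $x\in X$. Let $\operatorname{Aut}(X^*)$ be the group of rooted tree automorphisms of $X^*$. For $g\in\operatorname{Aut}(X^*)$ and $v\in X^*$, the section $g|_v\in\operatorname{Aut}(X^*)$ is defined by $g(vw)=g(v)\,g|_v(w)$ for all $w\in X^*$. The automorphism $g$ has bounded activity if there is $c\in\mathbb{N}$ such that for every $n\ge 0$ at most $c$ words $v\in X^n$ satisfy $g|_v\neq\mathrm{Id}$. The group $\operatorname{Aut}(X^*)$ acts on every level $X^n$ and on the space of ends $X^\omega$, the set of right-infinite words in $X$. An action of a group $A$ on a set $L$ is called recurrent if for every finitely supported symmetric probability measure $\lambda$ on $A$ and every $l_0\in L$, the random walk on $L$ induced by $\lambda$ and started at $l_0$ is recurrent; here the walk is $l_{n+1}=a_n\cdot l_n$ with $a_0,a_1,\dots$ independent of law $\lambda$, and recurrent means that almost surely it returns to $l_0$. For $S\subseteq A$, the Schreier graph $\Gamma(A,S,L)$ has vertex set $L$ and edges $x\to s(x)$ for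 $x\in L$, $s\in S$; if $S$ generates $A$, its components are $A$-invariant. Lemma. Let $G$ be a subgroup of $\operatorname{Aut}(X^*)$ generated by a finite set $S$, and suppose that every element of $G$ has bounded activity. Assume that for every $n\ge 0$ the action of $G$ on the level $X^n$ is recurrent. Then the action of $G$ on every component of the orbital Schreier graph $\Gamma(G,S,X^\omega)$ is recurrent. -/

import Mathlib

/-! ### The regular rooted tree `X^*` and its automorphisms -/

/-- The edges of the standard `X`-regular rooted tree: the vertices are the finite words in `X`
(the root is the empty word), and the edges are the pairs `(v, vx)`. -/
def TreeEdge {X : Type*} (v w : List X) : Prop := ∃ x : X, w = v ++ [x]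

/-- The rooted tree automorphisms of `X^*`, as a group of permutations of the vertex set: the bijections of the vertex set that fix
the root and preserve and reflect the edges. -/
def treeAutSubgroup (X : Type*) : Subgroup (Equiv.Perm (List X)) where
  carrier := {g | g [] = [] ∧ ∀ v w, TreeEdge (g v) (g w) ↔ TreeEdge v w}
  one_mem' := ⟨rfl, fun _ _ => Iff.rfl⟩
  mul_mem' := by
    rintro a b ⟨ha, ha'⟩ ⟨hb, hb'⟩
    refine ⟨by simp [Equiv.Perm.mul_apply, ha, hb], fun v w => ?_⟩
    simp only [Equiv.Perm.mul_apply]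
    rw [ha', hb']
  inv_mem' := by
    rintro a ⟨ha, ha'⟩
    refine ⟨by rw [Equiv.Perm.inv_eq_iff_eq, ha], fun v w => ?_⟩
    rw [← ha']
    simp

/-- The group `Aut(X^*)` of rooted tree automorphisms of `X^*`. -/
abbrev TreeAut (X : Type*) : Type _ := treeAutSubgroup X

namespace TreeAut

variable {X : Type*}

theorem apply_nil (g : TreeAut X) : g.1 [] = [] := g.2.1

theorem edge_iff (g : TreeAut X) (v w : List X) :
    TreeEdge (g.1 v) (g.1 w) ↔ TreeEdge v w := g.2.2 v w

theorem apply_snoc (g : TreeAut X) (v : List X) (x : X) :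
    ∃ y, g.1 (v ++ [x]) = g.1 v ++ [y] :=
  (g.edge_iff v (v ++ [x])).2 ⟨x, rfl⟩

theorem length_apply (g : TreeAut X) (v : List X) : (g.1 v).length = v.length := by
  induction v using List.reverseRecOn with
  | nil => rw [apply_nil]
  | append_singleton v x ih =>
    obtain ⟨y, hy⟩ := g.apply_snoc v x
    simp [hy, ih]

theorem prefix_apply (g : TreeAut X) (v w : List X) : ∃ u, g.1 (v ++ w) = g.1 v ++ u := by
  induction w using List.reverseRecOn with
  | nil => exact ⟨[], by simp⟩
  | append_singleton w x ih =>
    obtain ⟨u, hu⟩ := ih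
    obtain ⟨y, hy⟩ := g.apply_snoc (v ++ w) x
    exact ⟨u ++ [y], by rw [← List.append_assoc, hy, hu, List.append_assoc]⟩

/-- The word `g|_v (w)`, that is, `g (v w)` with its prefix `g v` removed. -/
def sectionFun (g : TreeAut X) (v w : List X) : List X := (g.1 (v ++ w)).drop v.length

/-- The defining property of sections: `g (v w) = g (v) g|_v (w)`. -/
theorem apply_append (g : TreeAut X) (v w : List X) :
    g.1 (v ++ w) = g.1 v ++ g.sectionFun v w := by
  obtain ⟨u, hu⟩ := g.prefix_apply v w
  rw [sectionFun, hu, ← g.length_apply v, List.drop_left]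

theorem sectionFun_inv (g : TreeAut X) (v w : List X) :
    (g⁻¹).sectionFun (g.1 v) (g.sectionFun v w) = w := by
  have h := (g⁻¹).apply_append (g.1 v) (g.sectionFun v w)
  rw [← g.apply_append] at h
  simpa using h.symm

theorem sectionFun_inv' (g : TreeAut X) (v w : List X) :
    g.sectionFun v ((g⁻¹).sectionFun (g.1 v) w) = w := by
  have h := (g⁻¹).sectionFun_inv (g.1 v) w
  simpa using h

/-- The section `g|_v` of the tree automorphism `g` along the word `v`. -/
def sec (g : TreeAut X) (v : List X) : TreeAut X :=
  ⟨{ toFun := g.sectionFun v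
     invFun := (g⁻¹).sectionFun (g.1 v)
     left_inv := g.sectionFun_inv v
     right_inv := g.sectionFun_inv' v }, by
    constructor
    · have h := g.apply_append v []
      simpa using h
    · intro a b
      have h := g.edge_iff (v ++ a) (v ++ b)
      rw [g.apply_append, g.apply_append] at h
      simpa [TreeEdge, List.append_assoc] using h⟩

/-- The activity `α_n(g)`, in `ℕ ∪ {∞}`: the number of words `v` of length `n` for which the
section `g|_v` is not trivial. -/
noncomputable def activity (g : TreeAut X) (n : ℕ) : ℕ∞ :=
  Set.encard {v : List X | v.length = n ∧ g.sec v ≠ 1}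

/-- `g` has bounded activity: there is `c ∈ ℕ` with `α_n(g) ≤ c` for all `n`. -/
def HasBoundedActivity (g : TreeAut X) : Prop :=
  ∃ c : ℕ, ∀ n : ℕ, g.activity n ≤ (c : ℕ∞)

end TreeAut

/-! ### The actions on the finite levels and on the space of ends -/

/-- The `n`-th level `X^n` of the tree: the words of length `n`. -/
def TreeLevel (X : Type*) (n : ℕ) : Type _ := {v : List X // v.length = n}

instance (X : Type*) (n : ℕ) : MulAction (TreeAut X) (TreeLevel X n) where
  smul g v := ⟨g.1 v.1, (g.length_apply v.1).trans v.2⟩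
  one_smul _ := rfl
  mul_smul _ _ _ := rfl

/-- The space of ends `X^ω`: the right infinite words in `X`. -/
def TreeEnds (X : Type*) : Type _ := ℕ → X

namespace TreeEnds

variable {X : Type*}

/-- The letter in position `n` of an infinite word (positions start at `0`). -/
def letter (w : TreeEnds X) (n : ℕ) : X := w n

/-- The prefix of length `n` of an infinite word. -/
def pre (w : TreeEnds X) (n : ℕ) : List X := (List.range n).map w.letter

theorem length_pre (w : TreeEnds X) (n : ℕ) : (w.pre n).length = n := by simp [pre]

theorem pre_succ (w : TreeEnds X) (n : ℕ) : w.pre (n + 1) = w.pre n ++ [w.letter n] := by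
  simp [pre, List.range_succ]

/-- The image of the infinite word `w` under `g`: its letter in position `n` is the last letter
of the image under `g` of the prefix of `w` of length `n + 1`. -/
def act (g : TreeAut X) (w : TreeEnds X) : TreeEnds X := fun n =>
  (g.1 (w.pre (n + 1))).get ⟨n, by rw [g.length_apply, length_pre]; exact n.lt_succ_self⟩

/-- The prefixes of `g w` are the images under `g` of the prefixes of `w`. -/
theorem pre_act (g : TreeAut X) (w : TreeEnds X) (n : ℕ) :
    (act g w).pre n = g.1 (w.pre n) := by
  induction n with
  | zero => exact g.apply_nil.symm
  | succ n ih =>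
    obtain ⟨y, hy⟩ := g.apply_snoc (w.pre n) (w.letter n)
    rw [← pre_succ] at hy
    have hn : (g.1 (w.pre n)).length = n := by rw [g.length_apply, length_pre]
    have h : (act g w).letter n = y := by
      simp [letter, act, hy, hn]
    rw [pre_succ, ih, h, hy]

theorem ext_pre {w w' : TreeEnds X} (h : ∀ n, w.pre n = w'.pre n) : w = w' := by
  funext n
  have h1 := h (n + 1)
  rw [pre_succ, pre_succ, h n] at h1
  have h2 : w.letter n = w'.letter n := by simpa using h1
  exact h2

end TreeEnds

instance (X : Type*) : MulAction (TreeAut X) (TreeEnds X) where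
  smul g w := TreeEnds.act g w
  one_smul w := TreeEnds.ext_pre fun n => TreeEnds.pre_act 1 w n
  mul_smul g h w := TreeEnds.ext_pre fun n => by
    change (TreeEnds.act (g * h) w).pre n = (TreeEnds.act g (TreeEnds.act h w)).pre n
    rw [TreeEnds.pre_act, TreeEnds.pre_act, TreeEnds.pre_act]
    rfl

/-! ### Recurrent actions -/

section Recurrence

variable {A L : Type*} [Group A] [MulAction A L]

/-- The position at time `n` of the walk on `L` that starts in `x` and has the increments
`a 0, a 1, …`, which act from the left. -/
def walkPos (x : L) (a : ℕ → A) : ℕ → L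
  | 0 => x
  | n + 1 => a n • walkPos x a n

/-- The random walk on `L` induced by the probability measure `μ` on `A` (with independent
increments of law `μ`) is recurrent for the starting point `x`: almost surely it returns
to `x`. -/
def IsRecurrentWalk (μ : PMF A) (x : L) : Prop :=
  letI : MeasurableSpace A := ⊤
  ∀ᵐ a ∂(MeasureTheory.Measure.infinitePi (fun _ : ℕ => μ.toMeasure)),
    ∃ n : ℕ, walkPos x a (n + 1) = x

variable (A L) in
/-- The action of `A` on `L` is recurrent: for every finitely supported symmetric probability
measure on `A`, the induced random walk on `L` is recurrent for all starting points. -/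
def IsRecurrentAction : Prop :=
  ∀ μ : PMF A, μ.support.Finite → (∀ a : A, μ a⁻¹ = μ a) → ∀ x : L, IsRecurrentWalk μ x

end Recurrence

/-! ### Schreier graphs -/

section Schreier

variable {A : Type*} [Group A]

/-- The underlying simple graph of the Schreier graph `Γ(A, S, L)`, which has the edges
`x → s x` for `x ∈ L` and `s ∈ S`. (Loops, parallel edges and the direction of the edges play no
role for the components.) -/
def schreierGraph (S : Set A) (L : Type*) [MulAction A L] : SimpleGraph L :=
  SimpleGraph.fromRel fun x y => ∃ s ∈ S, y = s • x

variable {L : Type*} [MulAction A L]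

theorem schreierGraph_reachable (S : Set A) (hS : Subgroup.closure S = ⊤) (a : A) :
    ∀ x : L, (schreierGraph S L).Reachable x (a • x) := by
  have ha : a ∈ Subgroup.closure S := hS ▸ Subgroup.mem_top a
  induction ha using Subgroup.closure_induction with
  | mem s hs =>
    intro x
    by_cases h : x = s • x
    · exact h ▸ SimpleGraph.Reachable.refl x
    · exact SimpleGraph.Adj.reachable
        ((SimpleGraph.fromRel_adj _ _ _).2 ⟨h, Or.inl ⟨s, hs, rfl⟩⟩)
  | one => intro x; rw [one_smul]
  | mul a b _ _ iha ihb => intro x; rw [mul_smul]; exact (ihb x).trans (iha _)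
  | inv a _ ih => intro x; simpa using (ih (a⁻¹ • x)).symm

/-- A component of the Schreier graph of a generating set `S`, as an `A`-invariant set. -/
def schreierComponent (S : Set A) (hS : Subgroup.closure S = ⊤)
    (C : (schreierGraph S L).ConnectedComponent) : SubMulAction A L where
  carrier := C.supp
  smul_mem' a x hx := by
    rw [SimpleGraph.ConnectedComponent.mem_supp_iff] at hx ⊢
    rw [← hx]
    exact SimpleGraph.ConnectedComponent.sound (schreierGraph_reachable S hS a x).symm

end Schreier

/-!
The proof compares Dirichlet forms. For a finitely supported symmetric measure `μ`, the walk
started in `x` is recurrent if and only if there are finitely supported functions with the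
value `1` at `x` and arbitrarily small energy `∑ μ(a) (f (a y) - f y)²`. One direction uses the
truncated hitting probabilities of `x`, whose energy is controlled by the escape probability
(`IsRecurrentWalk.exists_small_energy`); for the other direction, summation by parts against these
hitting probabilities bounds the escape probability by the energy of any such function
(`isRecurrentWalk_of_small_energy`).

On the space of ends, bounded activity gives finitely many singular ends, that is, ends `p` whose
tail is changed at arbitrarily large positions by some `a` in the support of `μ`
(`TreeEnds.finite_singularEnds`). Let `R` consist of the starting point `w`, of the singular
ends `p` and of their images `a p`. The tile of level `n` is the set of the ends that agree with an
element of `R` from position `n` on. It is a union of finitely many copies of the level `X^n`, so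
that a function of small energy on the level lifts to the tile. The lift, extended by zero, has
small energy, except on the edges between the tile and its complement. Over such an edge there is
a prefix of length `n` with a non-trivial section, so their number is bounded independently of `n`
(`TreeEnds.encard_tileCut_le`), and every given edge lies in finitely many of these cuts only
(`TreeEnds.eventually_notMem_tileCut`). Averaging the lifts over `k` levels whose cuts are disjoint
makes the contribution of the cuts `O(1/k)`, in the manner of the Nash-Williams criterion
(`isRecurrentWalk_of_cuts`).
-/

open MeasureTheory

/-! ### Return probabilities of a random walk -/

theorem countable_of_closure_finite {A : Type*} [Group A] {S : Set A} (hS : S.Finite)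
    (h : Subgroup.closure S = ⊤) : Countable A := by
  have : Countable S := hS.countable.to_subtype
  have : Function.Surjective (FreeGroup.lift (fun s : S => (s : A))) := by
    rw [← MonoidHom.range_eq_top, FreeGroup.range_lift_eq_closure]
    simpa using h
  exact this.countable

/-- The sequence `b, a 0, a 1, …`. -/
def consSeq {A : Type*} (b : A) (a : ℕ → A) : ℕ → A
  | 0 => b
  | n + 1 => a n

/-- An i.i.d. sequence is the same as one sample followed by an independent i.i.d. sequence. -/
theorem map_consSeq_infinitePi {A : Type*} [MeasurableSpace A] (ν : Measure A)
    [IsProbabilityMeasure ν] :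
    (ν.prod (Measure.infinitePi fun _ : ℕ => ν)).map (fun q => consSeq q.1 q.2) =
      Measure.infinitePi fun _ : ℕ => ν := by
  have hmeas : Measurable fun q : A × (ℕ → A) => consSeq q.1 q.2 := by
    refine measurable_pi_lambda _ fun n => ?_
    cases n with
    | zero => exact measurable_fst
    | succ n => exact (measurable_pi_apply n).comp measurable_snd
  refine Measure.eq_infinitePi _ fun s t ht => ?_
  classical
  -- A box over `s` is a box over an initial segment of `ℕ` with full sides outside of `s`.
  obtain ⟨N, hN⟩ : ∃ N, s ⊆ Finset.range (N + 1) :=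
    ⟨s.sup id, fun i hi => Finset.mem_range_succ_iff.2 (Finset.le_sup (f := id) hi)⟩
  set u : ℕ → Set A := fun i => if i ∈ s then t i else Set.univ with hu
  have hum : ∀ i, MeasurableSet (u i) := fun i => by
    by_cases h : i ∈ s <;> simp [hu, h, ht]
  have hbox : Set.pi s t = Set.pi (Finset.range (N + 1) : Finset ℕ) u := by
    ext a
    simp only [Set.mem_pi, Finset.mem_coe, hu]
    refine ⟨fun h i _ => ?_, fun h i hi => ?_⟩
    · by_cases hi : i ∈ s <;> simp [hi, h]
    · simpa [hi] using h i (hN hi)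
  have hprod : ∏ i ∈ s, ν (t i) = ∏ i ∈ Finset.range (N + 1), ν (u i) := by
    rw [← Finset.prod_subset hN (f := fun i => ν (u i))]
    · exact Finset.prod_congr rfl fun i hi => by simp [hu, hi]
    · intro i _ hi; simp [hu, hi]
  have hpre : (fun q : A × (ℕ → A) => consSeq q.1 q.2) ⁻¹'
      Set.pi (Finset.range (N + 1) : Finset ℕ) u =
      u 0 ×ˢ Set.pi (Finset.range N : Finset ℕ) (fun i => u (i + 1)) := by
    ext ⟨b, a⟩
    simp only [Set.mem_preimage, Set.mem_pi, Finset.mem_coe, Finset.mem_range, Set.mem_prod]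
    refine ⟨fun h => ⟨h 0 (by omega), fun i hi => h (i + 1) (by omega)⟩, ?_⟩
    rintro ⟨h0, h1⟩ (_ | i) hi
    · exact h0
    · exact h1 i (by omega)
  rw [hprod, hbox, Measure.map_apply hmeas
    (MeasurableSet.pi (Finset.countable_toSet _) fun i _ => hum i), hpre, Measure.prod_prod,
    Measure.infinitePi_pi _ (fun i _ => hum _), Finset.prod_range_succ', mul_comm]

section Hitting

variable {A L : Type*} [Group A] [MulAction A L]

/-- The Markov operator `f ↦ ∑ p a • f (a y)` of the random walk with the weights `p a`, for
`a ∈ s`. -/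
def markovOp (s : Finset A) (p : A → ℝ) (f : L → ℝ) (y : L) : ℝ := ∑ a ∈ s, p a * f (a • y)

open Classical in
/-- The probability that the random walk started in `y` visits `x` at one of the
times `0, …, n`. -/
noncomputable def hitProb (s : Finset A) (p : A → ℝ) (x : L) : ℕ → L → ℝ
  | 0, y => if y = x then 1 else 0
  | n + 1, y => if y = x then 1 else markovOp s p (hitProb s p x n) y

theorem walkPos_consSeq (y : L) (b : A) (a : ℕ → A) (n : ℕ) :
    walkPos y (consSeq b a) (n + 1) = walkPos (b • y) a n := by
  induction n with
  | zero => rfl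
  | succ n ih => rw [walkPos, ih]; rfl

theorem walkPos_eq_smul (y : L) (a : ℕ → A) (n : ℕ) : walkPos y a n = walkPos (1 : A) a n • y := by
  induction n with
  | zero => exact (one_smul A y).symm
  | succ n ih => rw [walkPos, walkPos, ih, smul_eq_mul, mul_smul]

theorem measurableSet_walkPos_eq [Countable A] [MeasurableSpace A] [DiscreteMeasurableSpace A]
    (y x : L) (n : ℕ) : MeasurableSet {a : ℕ → A | walkPos y a n = x} := by
  have h : Measurable fun a : ℕ → A => walkPos (1 : A) a n := by
    induction n with
    | zero => exact measurable_const
    | succ n ih => exact (measurable_pi_apply n).mul ih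
  simp_rw [walkPos_eq_smul y]
  exact h (MeasurableSet.of_discrete (s := {g : A | g • y = x}))

variable {s : Finset A} {p : A → ℝ} {x : L}

theorem markovOp_nonneg (hp : ∀ a, 0 ≤ p a) {f : L → ℝ} (hf : ∀ y, 0 ≤ f y) (y : L) :
    0 ≤ markovOp s p f y :=
  Finset.sum_nonneg fun a _ => mul_nonneg (hp a) (hf _)

theorem markovOp_mono (hp : ∀ a, 0 ≤ p a) {f g : L → ℝ} (hfg : ∀ y, f y ≤ g y) (y : L) :
    markovOp s p f y ≤ markovOp s p g y :=
  Finset.sum_le_sum fun a _ => mul_le_mul_of_nonneg_left (hfg _) (hp a)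

theorem hitProb_nonneg (hp : ∀ a, 0 ≤ p a) (n : ℕ) (y : L) : 0 ≤ hitProb s p x n y := by
  induction n generalizing y with
  | zero => rw [hitProb]; split_ifs <;> simp
  | succ n ih =>
    rw [hitProb]
    split_ifs
    · exact zero_le_one
    · exact markovOp_nonneg hp ih y

/-- The first step decomposition of the probability of a visit to `x` at one of the times
`1, …, n + 1`, given the probabilities of a visit at the times `0, …, n`. -/
theorem measure_visit_succ [Countable A] [MeasurableSpace A] [DiscreteMeasurableSpace A]
    (μ : PMF A) (hμ : μ.support.Finite) {n : ℕ} {h : L → ℝ} (h0 : ∀ y, 0 ≤ h y)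
    (hh : ∀ y, Measure.infinitePi (fun _ : ℕ => μ.toMeasure)
      {a | ∃ m ≤ n, walkPos y a m = x} = ENNReal.ofReal (h y)) (y : L) :
    Measure.infinitePi (fun _ : ℕ => μ.toMeasure) {a | ∃ m ≤ n, walkPos y a (m + 1) = x} =
      ENNReal.ofReal (markovOp hμ.toFinset (fun a => (μ a).toReal) h y) := by
  have hmeas : Measurable fun q : A × (ℕ → A) => consSeq q.1 q.2 := by
    refine measurable_pi_lambda _ fun n => ?_
    cases n with
    | zero => exact measurable_fst
    | succ n => exact (measurable_pi_apply n).comp measurable_snd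
  have hset : MeasurableSet {a : ℕ → A | ∃ m ≤ n, walkPos y a (m + 1) = x} := by
    have : {a : ℕ → A | ∃ m ≤ n, walkPos y a (m + 1) = x} =
        ⋃ m : ℕ, ⋃ _ : m ≤ n, {a | walkPos y a (m + 1) = x} := by ext; simp
    rw [this]
    exact MeasurableSet.iUnion fun m => MeasurableSet.iUnion fun _ =>
      measurableSet_walkPos_eq y x (m + 1)
  rw [← map_consSeq_infinitePi, Measure.map_apply hmeas hset, Measure.prod_apply (hmeas hset),
    lintegral_countable']
  have hterm : ∀ b : A, Measure.infinitePi (fun _ : ℕ => μ.toMeasure) (Prod.mk b ⁻¹'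
      ((fun q : A × (ℕ → A) => consSeq q.1 q.2) ⁻¹'
        {a | ∃ m ≤ n, walkPos y a (m + 1) = x})) = ENNReal.ofReal (h (b • y)) := by
    intro b
    rw [← hh]
    congr 1
    ext a
    simp [walkPos_consSeq]
  simp_rw [hterm, PMF.toMeasure_apply_singleton _ _ (MeasurableSet.singleton _)]
  rw [tsum_eq_sum (s := hμ.toFinset) (fun b hb => by
    have : μ b = 0 := by simpa using hb
    simp [this]), markovOp, ENNReal.ofReal_sum_of_nonneg
      (fun a _ => mul_nonneg ENNReal.toReal_nonneg (h0 _))]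
  refine Finset.sum_congr rfl fun a _ => ?_
  rw [ENNReal.ofReal_mul ENNReal.toReal_nonneg, ENNReal.ofReal_toReal (μ.apply_ne_top a),
    mul_comm]

theorem measure_visit [Countable A] [MeasurableSpace A] [DiscreteMeasurableSpace A]
    (μ : PMF A) (hμ : μ.support.Finite) (n : ℕ) (y : L) :
    Measure.infinitePi (fun _ : ℕ => μ.toMeasure) {a | ∃ m ≤ n, walkPos y a m = x} =
      ENNReal.ofReal (hitProb hμ.toFinset (fun a => (μ a).toReal) x n y) := by
  induction n generalizing y with
  | zero =>
    by_cases h : y = x <;> simp [hitProb, walkPos, h]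
  | succ n ih =>
    by_cases h : y = x
    · have : {a : ℕ → A | ∃ m ≤ n + 1, walkPos y a m = x} = Set.univ :=
        Set.eq_univ_of_forall fun a => ⟨0, by omega, h⟩
      rw [this, measure_univ, hitProb, if_pos h, ENNReal.ofReal_one]
    · have : {a : ℕ → A | ∃ m ≤ n + 1, walkPos y a m = x} =
          {a : ℕ → A | ∃ m ≤ n, walkPos y a (m + 1) = x} := by
        ext a
        constructor
        · rintro ⟨_ | m, hm, he⟩
          · exact absurd he h
          · exact ⟨m, by omega, he⟩
        · rintro ⟨m, hm, he⟩
          exact ⟨m + 1, by omega, he⟩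
      rw [this, hitProb, if_neg h]
      exact measure_visit_succ μ hμ (hitProb_nonneg (fun _ => ENNReal.toReal_nonneg) n) ih y

/-- The walk is recurrent if and only if the probabilities of a return to the starting point
within the first `n + 1` steps tend to `1`. -/
theorem isRecurrentWalk_iff_tendsto [Countable A] (μ : PMF A) (hμ : μ.support.Finite) (x : L) :
    IsRecurrentWalk μ x ↔ Filter.Tendsto
      (fun n => markovOp hμ.toFinset (fun a => (μ a).toReal)
        (hitProb hμ.toFinset (fun a => (μ a).toReal) x n) x) Filter.atTop (nhds 1) := by
  let _ : MeasurableSpace A := ⊤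
  have : DiscreteMeasurableSpace A := ⟨fun _ => trivial⟩
  set P : Measure (ℕ → A) := Measure.infinitePi (fun _ : ℕ => μ.toMeasure) with hP
  set E : ℕ → Set (ℕ → A) := fun n => {a | ∃ m ≤ n, walkPos x a (m + 1) = x} with hE
  have hPE : ∀ n, P (E n) = _ := fun n =>
    measure_visit_succ μ hμ (hitProb_nonneg (fun _ => ENNReal.toReal_nonneg) n)
      (measure_visit (x := x) μ hμ n) x
  have hmono : Monotone E := fun m n hmn a ⟨k, hk, he⟩ => ⟨k, hk.trans hmn, he⟩
  have hU : ⋃ n, E n = {a | ∃ n, walkPos x a (n + 1) = x} := by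
    ext a
    simp only [hE, Set.mem_iUnion, Set.mem_ofPred_eq]
    exact ⟨fun ⟨_, m, _, h⟩ => ⟨m, h⟩, fun ⟨m, h⟩ => ⟨m, m, le_rfl, h⟩⟩
  have hUm : MeasurableSet (⋃ n, E n) := by
    rw [hU, Set.ofPred_exists]
    exact MeasurableSet.iUnion fun n => measurableSet_walkPos_eq x x (n + 1)
  have hrec : IsRecurrentWalk μ x ↔ P (⋃ n, E n) = 1 := by
    rw [← mem_ae_iff_prob_eq_one hUm, hU]
    rfl
  have hlim := tendsto_measure_iUnion_atTop (μ := P) hmono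
  rw [hrec]
  constructor
  · intro h
    rw [h] at hlim
    have := (ENNReal.tendsto_toReal ENNReal.one_ne_top).comp hlim
    refine Filter.Tendsto.congr (fun n => ?_) this
    rw [Function.comp_apply, Function.comp_apply, hPE, ENNReal.toReal_ofReal]
    exact markovOp_nonneg (fun _ => ENNReal.toReal_nonneg)
      (hitProb_nonneg (fun _ => ENNReal.toReal_nonneg) n) x
  · intro h
    have := ENNReal.tendsto_ofReal h
    rw [ENNReal.ofReal_one] at this
    refine tendsto_nhds_unique hlim (this.congr fun n => ?_)
    rw [Function.comp_apply, hPE]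

end Hitting

/-! ### The Dirichlet form and recurrence -/

section Dirichlet

variable {A L : Type*} [Group A] [MulAction A L]

/-- The Dirichlet form of the random walk with the weights `p a`, for `a ∈ s`. It is used for
finitely supported functions only, for which the sum over `L` converges. -/
noncomputable def dirichletForm (s : Finset A) (p : A → ℝ) (f g : L → ℝ) : ℝ :=
  ∑ a ∈ s, p a * ∑' y, (f (a • y) - f y) * (g (a • y) - g y)

variable {s : Finset A} {p : A → ℝ} {x : L}

theorem hitProb_self (n : ℕ) : hitProb s p x n x = 1 := by
  cases n <;> rw [hitProb, if_pos rfl]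

theorem hitProb_le_one (hp : ∀ a, 0 ≤ p a) (h1 : ∑ a ∈ s, p a = 1) (n : ℕ) (y : L) :
    hitProb s p x n y ≤ 1 := by
  induction n generalizing y with
  | zero => rw [hitProb]; split_ifs <;> simp
  | succ n ih =>
    rw [hitProb]
    split_ifs
    · exact le_rfl
    · refine (markovOp_mono hp ih y).trans ?_
      simp [markovOp, h1]

theorem hitProb_le_succ (hp : ∀ a, 0 ≤ p a) (n : ℕ) (y : L) :
    hitProb s p x n y ≤ hitProb s p x (n + 1) y := by
  induction n generalizing y with
  | zero =>
    rw [hitProb, hitProb]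
    split_ifs
    · exact le_rfl
    · exact markovOp_nonneg hp (hitProb_nonneg hp 0) y
  | succ n ih =>
    rw [hitProb, hitProb]
    split_ifs
    · exact le_rfl
    · exact markovOp_mono hp ih y

theorem finite_support_smul {f : L → ℝ} (hf : f.support.Finite) (a : A) :
    (Function.support fun y => f (a • y)).Finite :=
  hf.preimage (MulAction.injective a).injOn

theorem finite_support_markovOp {f : L → ℝ} (hf : f.support.Finite) :
    (Function.support (markovOp s p f)).Finite := by
  refine (s.finite_toSet.biUnion fun a _ => finite_support_smul hf a).subset fun y hy => ?_
  obtain ⟨a, ha, h⟩ := Finset.exists_ne_zero_of_sum_ne_zero hy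
  exact Set.mem_biUnion ha (right_ne_zero_of_mul h)

theorem finite_support_hitProb (n : ℕ) : (Function.support (hitProb s p x n)).Finite := by
  induction n with
  | zero =>
    refine (Set.finite_singleton x).subset fun y hy => ?_
    by_contra h
    exact hy (if_neg h)
  | succ n ih =>
    refine ((Set.finite_singleton x).union (finite_support_markovOp (s := s) (p := p) ih)).subset
      fun y hy => ?_
    by_cases h : y = x
    · exact Or.inl h
    · rw [Function.mem_support, hitProb, if_neg h] at hy
      exact Or.inr hy

theorem summable_mul_left_of_finite_support {f : L → ℝ} (hf : f.support.Finite) (g : L → ℝ) :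
    Summable fun y => f y * g y :=
  summable_of_hasFiniteSupport (hf.subset (Function.support_mul_subset_left f g))

/-- Summation by parts. -/
theorem dirichletForm_eq (hs : ∀ a ∈ s, a⁻¹ ∈ s) (hsym : ∀ a, p a⁻¹ = p a)
    (h1 : ∑ a ∈ s, p a = 1) {f : L → ℝ} (hf : f.support.Finite) (g : L → ℝ) :
    dirichletForm s p f g = 2 * ∑' y, f y * (g y - markovOp s p g y) := by
  set T : A → ℝ := fun a => ∑' y, f y * g (a • y) with hT
  have hfs := summable_mul_left_of_finite_support hf
  have hterm : ∀ a : A, ∑' y, (f (a • y) - f y) * (g (a • y) - g y) =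
      2 * T 1 - T a - T a⁻¹ := by
    intro a
    have e1 : ∑' y, f (a • y) * g (a • y) = T 1 := by
      simp only [hT, one_smul]
      exact (MulAction.toPerm a).tsum_eq fun y => f y * g y
    have e2 : ∑' y, f (a • y) * g y = T a⁻¹ := by
      rw [← (MulAction.toPerm a⁻¹ : Equiv.Perm L).tsum_eq]
      simp [hT]
    have hfa := summable_mul_left_of_finite_support (finite_support_smul hf a)
    have e3 : ∀ y, (f (a • y) - f y) * (g (a • y) - g y) =
        ((f (a • y) * g (a • y) + f y * g ((1 : A) • y)) - f y * g (a • y)) - f (a • y) * g y :=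
      fun y => by rw [one_smul]; ring
    rw [tsum_congr e3, (((hfa _).add (hfs _)).sub (hfs _)).tsum_sub (hfa _),
      ((hfa _).add (hfs _)).tsum_sub (hfs _), (hfa _).tsum_add (hfs _), e1, e2]
    simp only [hT]
    ring
  have hinv : ∑ a ∈ s, p a * T a⁻¹ = ∑ a ∈ s, p a * T a :=
    Finset.sum_nbij' (fun a => a⁻¹) (fun a => a⁻¹) hs hs (by simp) (by simp)
      (fun a _ => by rw [hsym])
  have hright : ∑' y, f y * (g y - markovOp s p g y) = T 1 - ∑ a ∈ s, p a * T a := by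
    have e : ∀ y, f y * (g y - markovOp s p g y) =
        f y * g ((1 : A) • y) - ∑ a ∈ s, p a * (f y * g (a • y)) := fun y => by
      rw [one_smul, mul_sub, markovOp, Finset.mul_sum]
      congr 1
      exact Finset.sum_congr rfl fun a _ => by ring
    rw [tsum_congr e, (hfs _).tsum_sub (summable_sum fun a _ => (hfs _).mul_left _),
      Summable.tsum_finsetSum (fun a _ => (hfs _).mul_left _)]
    simp only [hT, tsum_mul_left]
  rw [hright, dirichletForm]
  simp_rw [hterm, mul_sub, Finset.sum_sub_distrib]
  rw [hinv, ← Finset.sum_mul, h1]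
  ring

/-- The energy of a truncated hitting probability is controlled by the escape probability: off
the target the function is subharmonic. -/
theorem dirichletForm_hitProb_le (hp : ∀ a, 0 ≤ p a) (hs : ∀ a ∈ s, a⁻¹ ∈ s)
    (hsym : ∀ a, p a⁻¹ = p a) (h1 : ∑ a ∈ s, p a = 1) (n : ℕ) :
    dirichletForm s p (hitProb s p x n) (hitProb s p x n) ≤
      2 * (1 - markovOp s p (hitProb s p x n) x) := by
  classical
  have hfin := finite_support_hitProb (s := s) (p := p) (x := x) n
  rw [dirichletForm_eq hs hsym h1 hfin]
  refine mul_le_mul_of_nonneg_left ?_ zero_le_two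
  rw [← tsum_ite_eq x (fun _ => 1 - markovOp s p (hitProb s p x n) x)]
  refine (summable_mul_left_of_finite_support hfin _).tsum_le_tsum (fun y => ?_)
    (summable_of_hasFiniteSupport ((Set.finite_singleton x).subset fun y hy => ?_))
  · split_ifs with h
    · rw [h, hitProb_self, one_mul]
    · refine mul_nonpos_of_nonneg_of_nonpos (hitProb_nonneg hp n y) ?_
      have := hitProb_le_succ (s := s) (x := x) hp n y
      rw [hitProb, if_neg h] at this
      linarith
  · by_contra h
    exact hy (if_neg h)

theorem two_mul_dirichletForm_le (hp : ∀ a, 0 ≤ p a) {f g : L → ℝ} (hf : f.support.Finite)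
    (hg : g.support.Finite) :
    2 * dirichletForm s p f g ≤ dirichletForm s p f f + dirichletForm s p g g := by
  have hsum : ∀ {u : L → ℝ} (_ : u.support.Finite) (v : L → ℝ) (a : A),
      Summable fun y => (u (a • y) - u y) * v y := fun {u} hu v a =>
    summable_mul_left_of_finite_support
      (((finite_support_smul hu a).union hu).subset (Function.support_sub _ _)) v
  simp only [dirichletForm]
  rw [Finset.mul_sum, ← Finset.sum_add_distrib]
  refine Finset.sum_le_sum fun a _ => ?_
  rw [mul_left_comm, ← mul_add, ← tsum_mul_left, ← (hsum hf _ a).tsum_add (hsum hg _ a)]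
  refine mul_le_mul_of_nonneg_left ?_ (hp a)
  refine ((hsum hf _ a).mul_left 2).tsum_le_tsum (fun y => ?_) ((hsum hf _ a).add (hsum hg _ a))
  nlinarith [sq_nonneg ((f (a • y) - f y) - (g (a • y) - g y))]

/-- The hitting probability is the minimiser of the energy: if finitely supported functions with
the value `1` at `x` have arbitrarily small energy, then the return probabilities tend to `1`. -/
theorem tendsto_return_of_small_energy (hp : ∀ a, 0 ≤ p a) (hs : ∀ a ∈ s, a⁻¹ ∈ s)
    (hsym : ∀ a, p a⁻¹ = p a) (h1 : ∑ a ∈ s, p a = 1)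
    (hE : ∀ ε > 0, ∃ f : L → ℝ, f.support.Finite ∧ f x = 1 ∧ dirichletForm s p f f ≤ ε) :
    Filter.Tendsto (fun n => markovOp s p (hitProb s p x n) x) Filter.atTop (nhds 1) := by
  set H : L → ℝ := fun y => ⨆ n, hitProb s p x n y
  have hH : ∀ y, Filter.Tendsto (fun n => hitProb s p x n y) Filter.atTop (nhds (H y)) := fun y =>
    tendsto_atTop_ciSup (monotone_nat_of_le_succ fun n => hitProb_le_succ hp n y)
      ⟨1, by rintro _ ⟨n, rfl⟩; exact hitProb_le_one hp h1 n y⟩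
  have hPH : ∀ y, Filter.Tendsto (fun n => markovOp s p (hitProb s p x n) y) Filter.atTop
      (nhds (markovOp s p H y)) := fun y =>
    tendsto_finsetSum _ fun a _ => (hH (a • y)).const_mul (p a)
  have hharm : ∀ y, y ≠ x → markovOp s p H y = H y := fun y hy => by
    refine tendsto_nhds_unique (hPH y) (((Filter.tendsto_add_atTop_iff_nat 1).2 (hH y)).congr
      fun n => ?_)
    rw [hitProb, if_neg hy]
  have hle : markovOp s p H x ≤ 1 := le_of_tendsto' (hPH x) fun n =>
    (markovOp_mono hp (hitProb_le_one hp h1 n) x).trans (by simp [markovOp, h1])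
  have hδ : ∀ ε > 0, 1 - markovOp s p H x ≤ ε := by
    intro ε hε
    obtain ⟨f, hf, hfx, hfE⟩ := hE ε hε
    have hlim : Filter.Tendsto (fun n => dirichletForm s p f (hitProb s p x n)) Filter.atTop
        (nhds (2 * (1 - markovOp s p H x))) := by
      have hval : 1 - markovOp s p H x = ∑ y ∈ hf.toFinset, f y * (H y - markovOp s p H y) := by
        have hHx : H x = 1 := by simp [H, hitProb_self]
        rw [Finset.sum_eq_single x, hfx, hHx, one_mul]
        · intro y _ hy
          rw [hharm y hy, sub_self, mul_zero]
        · intro h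
          simp [hfx] at h
      rw [hval]
      refine (Filter.Tendsto.const_mul 2 (tendsto_finsetSum hf.toFinset fun y _ =>
        ((hH y).sub (hPH y)).const_mul (f y))).congr fun n => ?_
      rw [dirichletForm_eq hs hsym h1 hf, tsum_eq_sum]
      intro y hy
      have : f y = 0 := by simpa using hy
      rw [this, zero_mul]
    have h2 : 2 * (2 * (1 - markovOp s p H x)) ≤ ε + 2 * (1 - markovOp s p H x) := by
      refine le_of_tendsto_of_tendsto' (hlim.const_mul 2)
        ((((hPH x).const_sub 1).const_mul 2).const_add ε) fun n => ?_
      have a1 := two_mul_dirichletForm_le (s := s) hp hf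
        (finite_support_hitProb (s := s) (p := p) (x := x) n)
      have a2 := dirichletForm_hitProb_le (x := x) hp hs hsym h1 n
      linarith
    linarith
  have hone : markovOp s p H x = 1 :=
    le_antisymm hle (by linarith [le_of_forall_pos_le_add fun ε hε =>
      (hδ ε hε).trans_eq (zero_add ε).symm])
  simpa [hone] using hPH x

end Dirichlet

section Criterion

theorem sum_toReal_support {A : Type*} (μ : PMF A) (hμ : μ.support.Finite) :
    ∑ a ∈ hμ.toFinset, (μ a).toReal = 1 := by
  rw [← ENNReal.toReal_sum fun a _ => μ.apply_ne_top a, ← ENNReal.toReal_one, ← μ.tsum_coe,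
    tsum_eq_sum (s := hμ.toFinset)]
  intro a ha
  simpa using ha

variable {A L : Type*} [Group A] [MulAction A L]

theorem inv_mem_support {μ : PMF A} (hμ : μ.support.Finite) (hsym : ∀ a, μ a⁻¹ = μ a) :
    ∀ a ∈ hμ.toFinset, a⁻¹ ∈ hμ.toFinset := by
  simp [hsym]

/-- The Dirichlet form of the random walk induced by a finitely supported probability measure. -/
noncomputable def PMF.dirichletForm (μ : PMF A) (hμ : μ.support.Finite) (f g : L → ℝ) : ℝ :=
  _root_.dirichletForm hμ.toFinset (fun a => (μ a).toReal) f g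

/-- The energy criterion for recurrence. -/
theorem isRecurrentWalk_of_small_energy [Countable A] {μ : PMF A} (hμ : μ.support.Finite)
    (hsym : ∀ a, μ a⁻¹ = μ a) {x : L}
    (hE : ∀ ε > 0, ∃ f : L → ℝ, f.support.Finite ∧ f x = 1 ∧ μ.dirichletForm hμ f f ≤ ε) :
    IsRecurrentWalk μ x :=
  (isRecurrentWalk_iff_tendsto μ hμ x).2 <| tendsto_return_of_small_energy
    (fun _ => ENNReal.toReal_nonneg) (inv_mem_support hμ hsym) (fun a => by rw [hsym])
    (sum_toReal_support μ hμ) hE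

/-- The converse of the energy criterion, with functions that take values in `[0, 1]`. -/
theorem IsRecurrentWalk.exists_small_energy [Countable A] {μ : PMF A} (hμ : μ.support.Finite)
    (hsym : ∀ a, μ a⁻¹ = μ a) {x : L} (h : IsRecurrentWalk μ x) {ε : ℝ} (hε : 0 < ε) :
    ∃ f : L → ℝ, f.support.Finite ∧ f x = 1 ∧ (∀ y, 0 ≤ f y) ∧ (∀ y, f y ≤ 1) ∧
      μ.dirichletForm hμ f f ≤ ε := by
  have hp : ∀ a, 0 ≤ (μ a).toReal := fun _ => ENNReal.toReal_nonneg
  obtain ⟨n, hn⟩ := (((isRecurrentWalk_iff_tendsto μ hμ x).1 h).eventually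
    (lt_mem_nhds (show 1 - ε / 2 < 1 by linarith))).exists
  refine ⟨_, finite_support_hitProb n, hitProb_self n, hitProb_nonneg hp n,
    hitProb_le_one hp (sum_toReal_support μ hμ) n, (dirichletForm_hitProb_le hp
      (inv_mem_support hμ hsym) (fun a => by rw [hsym]) (sum_toReal_support μ hμ) n).trans ?_⟩
  linarith

end Criterion

/-! ### Averaging over sparse cuts -/

/-- The square of an average, where the summands are split into a part that is estimated by
convexity and a part whose terms are mutually orthogonal. -/
theorem sq_average_add_le {k : ℕ} (hk : 0 < k) (I J : ℕ → ℝ)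
    (hJ : ∀ i j, i ≠ j → J i * J j = 0) :
    ((k : ℝ)⁻¹ * ∑ i ∈ Finset.range k, (I i + J i)) ^ 2 ≤
      2 * (k : ℝ)⁻¹ * ∑ i ∈ Finset.range k, I i ^ 2 +
        2 * (k : ℝ)⁻¹ ^ 2 * ∑ i ∈ Finset.range k, J i ^ 2 := by
  have hk' : (0 : ℝ) < k := Nat.cast_pos.2 hk
  have h1 : (∑ i ∈ Finset.range k, I i) ^ 2 ≤ k * ∑ i ∈ Finset.range k, I i ^ 2 := by
    simpa using sq_sum_le_card_mul_sum_sq (s := Finset.range k) (f := I)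
  have h2 : (∑ i ∈ Finset.range k, J i) ^ 2 = ∑ i ∈ Finset.range k, J i ^ 2 := by
    rw [sq, Finset.sum_mul_sum]
    refine Finset.sum_congr rfl fun i hi => ?_
    rw [Finset.sum_eq_single i (fun j _ hj => hJ i j hj.symm) (fun h => absurd hi h), sq]
  rw [Finset.sum_add_distrib, mul_pow]
  calc (k : ℝ)⁻¹ ^ 2 * (∑ i ∈ Finset.range k, I i + ∑ i ∈ Finset.range k, J i) ^ 2
      ≤ (k : ℝ)⁻¹ ^ 2 * (2 * (∑ i ∈ Finset.range k, I i) ^ 2 +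
          2 * (∑ i ∈ Finset.range k, J i) ^ 2) := by
        refine mul_le_mul_of_nonneg_left ?_ (by positivity)
        linarith [add_sq_le (a := ∑ i ∈ Finset.range k, I i) (b := ∑ i ∈ Finset.range k, J i)]
    _ ≤ (k : ℝ)⁻¹ ^ 2 * (2 * (k * ∑ i ∈ Finset.range k, I i ^ 2) +
          2 * ∑ i ∈ Finset.range k, J i ^ 2) := by
        rw [h2]
        gcongr
    _ = _ := by field_simp

theorem tsum_le_of_encard_le {L : Type*} {B : Set L} {M : ℕ} (hB : B.encard ≤ M) {f : L → ℝ}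
    (hf : ∀ y ∈ B, f y ≤ 1) : ∑' y, B.indicator f y ≤ M := by
  have hfin : B.Finite := Set.finite_of_encard_le_coe hB
  rw [tsum_eq_sum (s := hfin.toFinset) (fun y hy => Set.indicator_of_notMem (by simpa using hy) f)]
  calc ∑ y ∈ hfin.toFinset, B.indicator f y ≤ ∑ _y ∈ hfin.toFinset, (1 : ℝ) :=
        Finset.sum_le_sum fun y hy => by
          have hy' : y ∈ B := by simpa using hy
          rw [Set.indicator_of_mem hy']
          exact hf y hy'
    _ ≤ M := by
        rw [hfin.encard_eq_coe_toFinset_card] at hB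
        simpa using hB

section Cuts

variable {A L : Type*} [Group A] [MulAction A L]

/-- A version of the Nash-Williams criterion. Every `B n` is a cut: a set of at most `M` edges
`(y, a • y)` for every `a`, and every edge leaves the cuts eventually. If for every `n` there are
functions of arbitrarily small energy off the cut `B n`, then an average of such functions over
disjoint cuts has small energy. -/
theorem isRecurrentWalk_of_cuts [Countable A] {μ : PMF A} (hμ : μ.support.Finite)
    (hsym : ∀ a, μ a⁻¹ = μ a) {x : L} (M : ℕ) (B : ℕ → A → Set L)
    (hcard : ∀ n, ∀ a ∈ μ.support, (B n a).encard ≤ M)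
    (hev : ∀ a ∈ μ.support, ∀ y, ∀ᶠ n in Filter.atTop, y ∉ B n a)
    (hF : ∀ n, ∀ ε > 0, ∃ f : L → ℝ, f.support.Finite ∧ f x = 1 ∧ (∀ y, 0 ≤ f y) ∧
      (∀ y, f y ≤ 1) ∧ ∑ a ∈ hμ.toFinset, (μ a).toReal *
        ∑' y, (B n a)ᶜ.indicator (fun y => (f (a • y) - f y) ^ 2) y ≤ ε) :
    IsRecurrentWalk μ x := by
  classical
  refine isRecurrentWalk_of_small_energy hμ hsym fun ε hε => ?_
  choose F hFfin hFx hF0 hF1 hFE using fun n => hF n (ε / 4) (by linarith)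
  -- A sequence of indices with mutually disjoint cuts.
  obtain ⟨φ, hφ⟩ : ∃ φ : ℕ → ℕ, ∀ i j, i ≠ j →
      ∀ a ∈ μ.support, Disjoint (B (φ i) a) (B (φ j) a) := by
    have : Std.Symm fun i j : ℕ => ∀ a ∈ μ.support, Disjoint (B i a) (B j a) :=
      ⟨fun i j h a ha => (h a ha).symm⟩
    obtain ⟨φ, -, h⟩ := exists_seq_of_forall_finset_exists' (fun _ : ℕ => True)
      (fun i j => ∀ a ∈ μ.support, Disjoint (B i a) (B j a)) fun t _ => by
        have : ∀ᶠ n in Filter.atTop, ∀ i ∈ t, ∀ a ∈ μ.support, ∀ y ∈ B i a, y ∉ B n a := by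
          refine (Filter.eventually_all_finset t).2 fun i _ =>
            (Filter.eventually_all_finite hμ).2 fun a ha =>
              (Filter.eventually_all_finite
                (Set.finite_of_encard_le_coe (hcard i a ha))).2 fun y _ => hev a ha y
        obtain ⟨n, hn⟩ := this.exists
        exact ⟨n, trivial, fun i hi a ha => Set.disjoint_left.2 (hn i hi a ha)⟩
    exact ⟨φ, fun i j hij => h hij⟩
  obtain ⟨k, hk⟩ := exists_nat_gt (max 0 (4 * M / ε))
  have hk0 : (0 : ℝ) < k := (le_max_left _ _).trans_lt hk
  have hkM : 2 * (k : ℝ)⁻¹ * M ≤ ε / 2 := by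
    have h := (le_max_right _ _).trans_lt hk
    rw [div_lt_iff₀ hε] at h
    rw [mul_assoc, mul_comm (k : ℝ)⁻¹, ← div_eq_mul_inv, ← mul_div_assoc, div_le_iff₀ hk0]
    linarith
  set D : ℕ → A → L → ℝ := fun i a y => F (φ i) (a • y) - F (φ i) y with hD
  have hDfin : ∀ i a, (D i a).support.Finite := fun i a =>
    ((finite_support_smul (hFfin _) a).union (hFfin _)).subset (Function.support_sub _ _)
  have hsum : ∀ (E : Set L) i a, Summable (E.indicator fun y => D i a y ^ 2) := fun E i a => by
    refine summable_of_hasFiniteSupport ((hDfin i a).subset fun y hy => ?_)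
    have : D i a y ^ 2 ≠ 0 := fun h => hy (by by_cases hE : y ∈ E <;> simp [hE, h])
    simpa using this
  have hD1 : ∀ i a y, D i a y ^ 2 ≤ 1 := fun i a y => by
    rw [sq_le_one_iff_abs_le_one, abs_le]
    have := hF0 (φ i) y; have := hF1 (φ i) y
    have := hF0 (φ i) (a • y); have := hF1 (φ i) (a • y)
    constructor <;> simp only [hD] <;> linarith
  refine ⟨fun y => (k : ℝ)⁻¹ * ∑ i ∈ Finset.range k, F (φ i) y, ?_, ?_, ?_⟩
  · refine ((Finset.range k).finite_toSet.biUnion fun i _ => hFfin (φ i)).subset fun y hy => ?_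
    obtain ⟨i, hi, h⟩ := Finset.exists_ne_zero_of_sum_ne_zero (right_ne_zero_of_mul hy)
    exact Set.mem_biUnion hi h
  · simp [hFx, hk0.ne']
  · have hpoint : ∀ a ∈ μ.support, ∀ y,
        ((k : ℝ)⁻¹ * ∑ i ∈ Finset.range k, F (φ i) (a • y) -
          (k : ℝ)⁻¹ * ∑ i ∈ Finset.range k, F (φ i) y) ^ 2 ≤
        2 * (k : ℝ)⁻¹ * ∑ i ∈ Finset.range k, (B (φ i) a)ᶜ.indicator (fun y => D i a y ^ 2) y +
          2 * (k : ℝ)⁻¹ ^ 2 *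
            ∑ i ∈ Finset.range k, (B (φ i) a).indicator (fun y => D i a y ^ 2) y := by
      intro a ha y
      have := sq_average_add_le (Nat.cast_pos.1 hk0)
        (fun i => (B (φ i) a)ᶜ.indicator (D i a) y) (fun i => (B (φ i) a).indicator (D i a) y)
        fun i j hij => by
          by_cases h : y ∈ B (φ i) a
          · have h' : y ∉ B (φ j) a := Set.disjoint_left.1 (hφ i j hij a ha) h
            simp [h']
          · simp [h]
      have hsq : ∀ (E : Set L) i, E.indicator (D i a) y ^ 2 =
          E.indicator (fun y => D i a y ^ 2) y := fun E i => by
        by_cases h : y ∈ E <;> simp [h]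
      simp only [Set.indicator_compl_add_self_apply, hsq] at this
      rwa [← mul_sub, ← Finset.sum_sub_distrib]
    have hedge : ∀ a ∈ hμ.toFinset,
        ∑' y, ((k : ℝ)⁻¹ * ∑ i ∈ Finset.range k, F (φ i) (a • y) -
          (k : ℝ)⁻¹ * ∑ i ∈ Finset.range k, F (φ i) y) *
          ((k : ℝ)⁻¹ * ∑ i ∈ Finset.range k, F (φ i) (a • y) -
          (k : ℝ)⁻¹ * ∑ i ∈ Finset.range k, F (φ i) y) ≤
        2 * (k : ℝ)⁻¹ * ∑ i ∈ Finset.range k,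
          ∑' y, (B (φ i) a)ᶜ.indicator (fun y => D i a y ^ 2) y + 2 * (k : ℝ)⁻¹ * M := by
      intro a ha
      have ha' : a ∈ μ.support := by simpa using ha
      have s1 := (summable_sum fun i (_ : i ∈ Finset.range k) =>
        hsum (B (φ i) a)ᶜ i a).mul_left (2 * (k : ℝ)⁻¹)
      have s2 := (summable_sum fun i (_ : i ∈ Finset.range k) =>
        hsum (B (φ i) a) i a).mul_left (2 * (k : ℝ)⁻¹ ^ 2)
      refine (Summable.tsum_le_tsum (fun y => ?_) ?_ (s1.add s2)).trans ?_
      · rw [← sq]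
        exact hpoint a ha' y
      · exact (s1.add s2).of_nonneg_of_le (fun y => mul_self_nonneg _)
          (fun y => by rw [← sq]; exact hpoint a ha' y)
      · rw [s1.tsum_add s2, tsum_mul_left, tsum_mul_left,
          Summable.tsum_finsetSum fun i _ => hsum _ i a,
          Summable.tsum_finsetSum fun i _ => hsum _ i a]
        have hM : ∑ i ∈ Finset.range k, ∑' y, (B (φ i) a).indicator (fun y => D i a y ^ 2) y ≤
            k * M := by
          refine (Finset.sum_le_sum fun i _ =>
            tsum_le_of_encard_le (hcard (φ i) a ha') fun y _ => hD1 i a y).trans ?_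
          simp
        have := mul_le_mul_of_nonneg_left hM (show (0 : ℝ) ≤ 2 * (k : ℝ)⁻¹ ^ 2 by positivity)
        have e : 2 * (k : ℝ)⁻¹ ^ 2 * (k * M) = 2 * (k : ℝ)⁻¹ * M := by field_simp
        rw [e] at this
        gcongr
    rw [PMF.dirichletForm, dirichletForm]
    refine (Finset.sum_le_sum fun a ha =>
      mul_le_mul_of_nonneg_left (hedge a ha) ENNReal.toReal_nonneg).trans ?_
    simp_rw [mul_add, Finset.sum_add_distrib, ← Finset.sum_mul, sum_toReal_support μ hμ, one_mul,
      mul_left_comm _ (2 * (k : ℝ)⁻¹), ← Finset.mul_sum]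
    have hI : ∑ a ∈ hμ.toFinset, (μ a).toReal * ∑ i ∈ Finset.range k,
        ∑' y, (B (φ i) a)ᶜ.indicator (fun y => D i a y ^ 2) y ≤ k * (ε / 4) := by
      simp_rw [Finset.mul_sum]
      rw [Finset.sum_comm]
      refine (Finset.sum_le_sum fun i _ => hFE (φ i)).trans ?_
      simp
    have := mul_le_mul_of_nonneg_left hI (show (0 : ℝ) ≤ 2 * (k : ℝ)⁻¹ by positivity)
    have e : 2 * (k : ℝ)⁻¹ * (k * (ε / 4)) = ε / 2 := by field_simp; ring
    linarith

end Cuts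

/-! ### Tiles of the space of ends -/

namespace TreeEnds

variable {X : Type*}

theorem pre_smul (g : TreeAut X) (w : TreeEnds X) (n : ℕ) : (g • w).pre n = g.1 (w.pre n) :=
  pre_act g w n

theorem pre_add (w : TreeEnds X) (n j : ℕ) : ∃ u, w.pre (n + j) = w.pre n ++ u := by
  induction j with
  | zero => exact ⟨[], by simp⟩
  | succ j ih =>
    obtain ⟨u, hu⟩ := ih
    exact ⟨u ++ [w.letter (n + j)], by rw [← add_assoc, pre_succ, hu, List.append_assoc]⟩

theorem getD_pre (w : TreeEnds X) (n k : ℕ) (x : X) :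
    (w.pre n).getD k x = if k < n then w.letter k else x := by
  by_cases h : k < n <;> simp [pre, h]

/-- If two ends have the same prefix of some length, then they have the same shorter prefixes. -/
theorem pre_eq_of_le {p q : TreeEnds X} {m n : ℕ} (hmn : m ≤ n) (h : p.pre n = q.pre n) :
    p.pre m = q.pre m := by
  obtain ⟨j, rfl⟩ := Nat.exists_eq_add_of_le hmn
  obtain ⟨u, hu⟩ := p.pre_add m j
  obtain ⟨v, hv⟩ := q.pre_add m j
  rw [hu, hv] at h
  exact (List.append_inj h (by simp [length_pre])).1

/-- An automorphism with trivial section at a prefix of an end does not change the letters after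
this prefix. -/
theorem letter_smul_of_sec_eq_one {g : TreeAut X} {w : TreeEnds X} {n : ℕ}
    (h : g.sec (w.pre n) = 1) {k : ℕ} (hk : n ≤ k) : (g • w).letter k = w.letter k := by
  have happ : ∀ u, g.1 (w.pre n ++ u) = g.1 (w.pre n) ++ u := fun u => by
    rw [g.apply_append]
    exact congrArg (g.1 (w.pre n) ++ ·) (congrArg (fun f : TreeAut X => f.1 u) h)
  obtain ⟨j, rfl⟩ := Nat.exists_eq_add_of_le hk
  obtain ⟨u, hu⟩ := w.pre_add n j
  have h1 := (g • w).pre_succ (n + j)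
  rw [pre_smul, pre_smul, pre_succ, hu, List.append_assoc, happ, happ, ← List.append_assoc] at h1
  simpa using h1.symm

/-- The letters of `w` with the word `v` written over the first ones. -/
def overwrite (v : List X) (w : TreeEnds X) : TreeEnds X := fun k => v.getD k (w.letter k)

theorem pre_overwrite (v : List X) (w : TreeEnds X) : (overwrite v w).pre v.length = v := by
  refine List.ext_getElem (by simp [pre]) fun i h1 h2 => ?_
  simp [pre, letter, overwrite, h2]

/-- The ends that agree from position `n` on with one of the ends in `R`. -/
def tile (R : Set (TreeEnds X)) (n : ℕ) : Set (TreeEnds X) :=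
  {p | ∃ r ∈ R, ∀ k, n ≤ k → p.letter k = r.letter k}

theorem subset_tile (R : Set (TreeEnds X)) (n : ℕ) : R ⊆ tile R n :=
  fun r hr => ⟨r, hr, fun _ _ => rfl⟩

theorem exists_overwrite_of_mem_tile {R : Set (TreeEnds X)} {n : ℕ} {p : TreeEnds X}
    (hp : p ∈ tile R n) : ∃ r ∈ R, overwrite (p.pre n) r = p := by
  obtain ⟨r, hr, h⟩ := hp
  refine ⟨r, hr, funext fun k => ?_⟩
  rw [overwrite, getD_pre]
  split_ifs with hk
  · rfl
  · exact (h k (not_lt.1 hk)).symm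

theorem encard_tile_pre_le (R : Set (TreeEnds X)) (n : ℕ) (V : Set (List X)) :
    {p | p ∈ tile R n ∧ p.pre n ∈ V}.encard ≤ V.encard * R.encard := by
  rw [← Set.encard_prod]
  refine (Set.encard_le_encard ?_).trans
    (Set.encard_image_le (fun q : List X × TreeEnds X => overwrite q.1 q.2) (V ×ˢ R))
  rintro p ⟨hp, hV⟩
  obtain ⟨r, hr, h⟩ := exists_overwrite_of_mem_tile hp
  exact ⟨(p.pre n, r), ⟨hV, hr⟩, h⟩

/-- The ends whose tail is changed by `g` at arbitrarily large positions. -/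
def singularEnds (g : TreeAut X) : Set (TreeEnds X) :=
  {p | ∀ n, ∃ k, n ≤ k ∧ (g • p).letter k ≠ p.letter k}

theorem sec_ne_one_of_mem_singularEnds {g : TreeAut X} {p : TreeEnds X} (hp : p ∈ singularEnds g)
    (n : ℕ) : g.sec (p.pre n) ≠ 1 := fun h => by
  obtain ⟨k, hk, hne⟩ := hp n
  exact hne (letter_smul_of_sec_eq_one h hk)

/-- An automorphism of bounded activity has finitely many singular ends: the prefixes of length
`n` of distinct ones are distinct for large `n`, and have non-trivial sections. -/
theorem finite_singularEnds {g : TreeAut X} (hg : g.HasBoundedActivity) :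
    (singularEnds g).Finite := by
  obtain ⟨c, hc⟩ := hg
  by_contra hinf
  obtain ⟨t, htS, htc⟩ := Set.Infinite.exists_subset_card_eq hinf (c + 1)
  have hsep : ∀ᶠ n in Filter.atTop, ∀ p ∈ t, ∀ q ∈ t, p.pre n = q.pre n → p = q := by
    refine (Filter.eventually_all_finset t).2 fun p _ =>
      (Filter.eventually_all_finset t).2 fun q _ => ?_
    by_cases h : p = q
    · exact Filter.Eventually.of_forall fun _ _ => h
    · obtain ⟨m, hm⟩ : ∃ m, p.pre m ≠ q.pre m := by
        by_contra! hall
        exact h (ext_pre hall)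
      filter_upwards [Filter.eventually_ge_atTop m] with n hn he
      exact absurd (pre_eq_of_le hn he) hm
  obtain ⟨n, hn⟩ := hsep.exists
  have h1 : ((fun p : TreeEnds X => p.pre n) '' (t : Set (TreeEnds X))).encard ≤ c := by
    refine (Set.encard_le_encard ?_).trans (hc n)
    rintro _ ⟨p, hp, rfl⟩
    exact ⟨length_pre p n, sec_ne_one_of_mem_singularEnds (htS hp) n⟩
  rw [Set.InjOn.encard_image fun p hp q hq h => hn p hp q hq h, Set.encard_coe_eq_coe_finsetCard,
    htc] at h1
  exact absurd (Nat.cast_le.1 h1) (by omega)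

/-- The points `p` of the space of ends for which the edge `(p, g • p)` joins the tile to its
complement. -/
def tileCut (R : Set (TreeEnds X)) (g : TreeAut X) (n : ℕ) : Set (TreeEnds X) :=
  {p | ¬(p ∈ tile R n ↔ g • p ∈ tile R n)}

theorem mem_tile_congr {R : Set (TreeEnds X)} {p q : TreeEnds X} {n : ℕ}
    (h : ∀ k, n ≤ k → p.letter k = q.letter k) : p ∈ tile R n ↔ q ∈ tile R n := by
  constructor <;> rintro ⟨r, hr, he⟩
  · exact ⟨r, hr, fun k hk => (h k hk).symm.trans (he k hk)⟩
  · exact ⟨r, hr, fun k hk => (h k hk).trans (he k hk)⟩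

theorem encard_tileCut_le (R : Set (TreeEnds X)) (g : TreeAut X) (n : ℕ) :
    (tileCut R g n).encard ≤ g.activity n * R.encard + g.activity n * R.encard := by
  set V : Set (List X) := {v : List X | v.length = n ∧ g.sec v ≠ 1}
  have hsub : tileCut R g n ⊆ {p | p ∈ tile R n ∧ p.pre n ∈ V} ∪
      (g⁻¹ • ·) '' {p | p ∈ tile R n ∧ p.pre n ∈ g.1 '' V} := by
    intro p hp
    have hV : p.pre n ∈ V := ⟨length_pre p n, fun h => hp
      (mem_tile_congr fun k hk => (letter_smul_of_sec_eq_one h hk).symm)⟩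
    by_cases h : p ∈ tile R n
    · exact Or.inl ⟨h, hV⟩
    · have h' : g • p ∈ tile R n := by
        by_contra h'
        exact hp ⟨fun h1 => absurd h1 h, fun h1 => absurd h1 h'⟩
      exact Or.inr ⟨g • p, ⟨h', p.pre n, hV, (pre_smul g p n).symm⟩, inv_smul_smul g p⟩
  refine (Set.encard_le_encard hsub).trans ((Set.encard_union_le _ _).trans (add_le_add
    (encard_tile_pre_le R n V) ((Set.encard_image_le _ _).trans
      ((encard_tile_pre_le R n _).trans (mul_le_mul_left (Set.encard_image_le _ _) _)))))

theorem eventually_notMem_tileCut {R : Set (TreeEnds X)} {g : TreeAut X}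
    (hR : ∀ p ∈ singularEnds g, p ∈ R ∧ g • p ∈ R) (p : TreeEnds X) :
    ∀ᶠ n in Filter.atTop, p ∉ tileCut R g n := by
  by_cases hp : p ∈ singularEnds g
  · refine Filter.Eventually.of_forall fun n h => h ?_
    exact iff_of_true (subset_tile R n (hR p hp).1) (subset_tile R n (hR p hp).2)
  · simp only [singularEnds, Set.mem_ofPred_eq, not_forall, not_exists, not_and, not_not] at hp
    obtain ⟨N, hN⟩ := hp
    filter_upwards [Filter.eventually_ge_atTop N] with n hn h
    exact h (mem_tile_congr fun k hk => (hN k (hn.trans hk)).symm)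

/-- The prefix of length `n` of an end, as a vertex of the level `n`. -/
def preLevel (w : TreeEnds X) (n : ℕ) : TreeLevel X n := ⟨w.pre n, w.length_pre n⟩

theorem preLevel_smul (g : TreeAut X) (w : TreeEnds X) (n : ℕ) :
    (g • w).preLevel n = g • w.preLevel n := Subtype.ext (pre_smul g w n)

open Classical in
/-- The function on the space of ends that lifts a function on a level to the tile, and is zero
off the tile. -/
noncomputable def liftTile (R : Set (TreeEnds X)) (n : ℕ) (f : TreeLevel X n → ℝ)
    (p : TreeEnds X) : ℝ := if p ∈ tile R n then f (p.preLevel n) else 0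

theorem support_liftTile_subset (R : Set (TreeEnds X)) (n : ℕ) (f : TreeLevel X n → ℝ) :
    (liftTile R n f).support ⊆ (fun q : TreeLevel X n × TreeEnds X => overwrite q.1.1 q.2) ''
      (f.support ×ˢ R) := by
  intro p hp
  have hpt : p ∈ tile R n := by
    by_contra h
    exact hp (if_neg h)
  rw [Function.mem_support, liftTile, if_pos hpt] at hp
  obtain ⟨r, hr, h⟩ := exists_overwrite_of_mem_tile hpt
  exact ⟨(p.preLevel n, r), ⟨hp, hr⟩, h⟩

theorem finite_support_liftTile {R : Set (TreeEnds X)} (hR : R.Finite) {n : ℕ}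
    {f : TreeLevel X n → ℝ} (hf : f.support.Finite) : (liftTile R n f).support.Finite :=
  ((hf.prod hR).image _).subset (support_liftTile_subset R n f)

theorem tsum_liftTile_le {R : Set (TreeEnds X)} (hR : R.Finite) {n : ℕ}
    {f : TreeLevel X n → ℝ} (hf : f.support.Finite) (h0 : ∀ v, 0 ≤ f v) :
    ∑' p, liftTile R n f p ≤ hR.toFinset.card * ∑' v, f v := by
  classical
  set J : TreeLevel X n × TreeEnds X → TreeEnds X := fun q => overwrite q.1.1 q.2
  have hJ : ∀ q, (J q).preLevel n = q.1 := by
    rintro ⟨⟨v, rfl⟩, r⟩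
    exact Subtype.ext (pre_overwrite v r)
  have hnn : ∀ p, 0 ≤ liftTile R n f p := fun p => by
    rw [liftTile]; split_ifs
    · exact h0 _
    · exact le_rfl
  rw [tsum_eq_sum (s := (hf.toFinset ×ˢ hR.toFinset).image J), tsum_eq_sum (s := hf.toFinset)]
  · calc ∑ p ∈ (hf.toFinset ×ˢ hR.toFinset).image J, liftTile R n f p
        ≤ ∑ q ∈ hf.toFinset ×ˢ hR.toFinset, liftTile R n f (J q) := by
          exact Finset.sum_image_le_of_nonneg fun _ _ => hnn _
      _ ≤ ∑ q ∈ hf.toFinset ×ˢ hR.toFinset, f q.1 := by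
          refine Finset.sum_le_sum fun q _ => ?_
          rw [liftTile, hJ]; split_ifs
          · exact le_rfl
          · exact h0 _
      _ = hR.toFinset.card * ∑ v ∈ hf.toFinset, f v := by
          rw [Finset.sum_product, Finset.mul_sum]
          simp
  · intro v hv
    simpa using hv
  · intro p hp
    by_contra h
    obtain ⟨q, hq, rfl⟩ := support_liftTile_subset R n f h
    exact hp (Finset.mem_image_of_mem J (by simpa [Set.mem_prod] using hq))

/-- Off the cut, a lifted function has at most as many copies of the energy of the original
function as there are ends in `R`. -/
theorem tsum_liftTile_off_tileCut_le {R : Set (TreeEnds X)} (hR : R.Finite) (g : TreeAut X)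
    {n : ℕ} {f : TreeLevel X n → ℝ} (hf : f.support.Finite) :
    ∑' p, (tileCut R g n)ᶜ.indicator
        (fun p => (liftTile R n f (g • p) - liftTile R n f p) ^ 2) p ≤
      hR.toFinset.card * ∑' v, (f (g • v) - f v) * (f (g • v) - f v) := by
  set e : TreeLevel X n → ℝ := fun v => (f (g • v) - f v) * (f (g • v) - f v) with he
  have hefin : e.support.Finite :=
    (((finite_support_smul hf g).union hf).subset (Function.support_sub _ _)).subset
      (Function.support_mul_subset_left _ _)
  have hnn : ∀ p, 0 ≤ liftTile R n e p := fun p => by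
    rw [liftTile]; split_ifs
    · exact mul_self_nonneg _
    · exact le_rfl
  have hs : Summable (liftTile R n e) := summable_of_hasFiniteSupport (finite_support_liftTile hR hefin)
  have hle : ∀ p, (tileCut R g n)ᶜ.indicator
      (fun p => (liftTile R n f (g • p) - liftTile R n f p) ^ 2) p ≤ liftTile R n e p := fun p => by
    by_cases hp : p ∈ tileCut R g n
    · simpa [hp] using hnn p
    · have hiff : p ∈ tile R n ↔ g • p ∈ tile R n := not_not.1 hp
      rw [Set.indicator_of_mem hp]
      by_cases ht : p ∈ tile R n
      · simp only [liftTile, if_pos ht, if_pos (hiff.1 ht), preLevel_smul, he, sq, le_refl]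
      · simp only [liftTile, if_neg ht, if_neg (mt hiff.2 ht), sub_zero]
        norm_num
  refine (Summable.tsum_le_tsum hle (hs.of_nonneg_of_le (fun p =>
    Set.indicator_nonneg (fun p _ => sq_nonneg _) p) hle) hs).trans
      (tsum_liftTile_le hR hefin fun v => mul_self_nonneg _)

end TreeEnds

/-! ### Recurrence on the space of ends -/

/-- The walk on an invariant subset is the restriction of the walk on the whole set. -/
theorem isRecurrentWalk_subMulAction_iff {A L : Type*} [Group A] [MulAction A L]
    (Y : SubMulAction A L) (μ : PMF A) (y : Y) :
    IsRecurrentWalk μ y ↔ IsRecurrentWalk μ (y : L) := by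
  have h : ∀ (a : ℕ → A) n, ((walkPos y a n : Y) : L) = walkPos (y : L) a n := by
    intro a n
    induction n with
    | zero => rfl
    | succ n ih => rw [walkPos, walkPos, ← ih]; rfl
  simp only [IsRecurrentWalk, ← h, Subtype.ext_iff]

open TreeEnds in
/-- Recurrence on all levels implies recurrence on the space of ends. -/
theorem isRecurrentAction_treeEnds {X : Type*} (G : Subgroup (TreeAut X)) [Countable G]
    (hbdd : ∀ g ∈ G, g.HasBoundedActivity)
    (hlevel : ∀ n : ℕ, IsRecurrentAction G (TreeLevel X n)) :
    IsRecurrentAction G (TreeEnds X) := by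
  intro μ hμ hsym w
  -- The walk leaves the tails of `w` only through a singular end of some `g` in the support.
  set R : Set (TreeEnds X) := {w} ∪ ⋃ g ∈ μ.support,
    (singularEnds g.1 ∪ (g.1 • ·) '' singularEnds g.1) with hRdef
  have hR : R.Finite := (Set.finite_singleton w).union <| hμ.biUnion fun g _ =>
    (finite_singularEnds (hbdd g.1 g.2)).union ((finite_singularEnds (hbdd g.1 g.2)).image _)
  have hRg : ∀ g ∈ μ.support, ∀ p ∈ singularEnds g.1, p ∈ R ∧ g.1 • p ∈ R := fun g hg p hp =>
    ⟨Or.inr (Set.mem_biUnion hg (Or.inl hp)), Or.inr (Set.mem_biUnion hg (Or.inr ⟨p, hp, rfl⟩))⟩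
  have hwR : w ∈ R := Or.inl rfl
  choose c hc using fun g : G => hbdd g.1 g.2
  set K := hR.toFinset.card with hK
  refine isRecurrentWalk_of_cuts hμ hsym
    (hμ.toFinset.sup c * K + hμ.toFinset.sup c * K) (fun n g => tileCut R g.1 n)
    (fun n g hg => ?_) (fun g hg p => eventually_notMem_tileCut (hRg g hg) p) fun n ε hε => ?_
  · have hact : g.1.activity n ≤ ((hμ.toFinset.sup c : ℕ) : ℕ∞) :=
      (hc g n).trans (Nat.cast_le.2 (Finset.le_sup (f := c) (by simpa using hg)))
    refine (encard_tileCut_le R g.1 n).trans ?_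
    rw [hR.encard_eq_coe_toFinset_card, ← hK]
    push_cast
    gcongr
  · obtain ⟨f, hf, hfw, hf0, hf1, hfE⟩ := (hlevel n μ hμ hsym
      (w.preLevel n)).exists_small_energy hμ hsym (show 0 < ε / (K + 1) by positivity)
    refine ⟨liftTile R n f, finite_support_liftTile hR hf, ?_, fun p => ?_, fun p => ?_, ?_⟩
    · rw [liftTile, if_pos (subset_tile R n hwR), hfw]
    · rw [liftTile]; split_ifs
      · exact hf0 _
      · exact le_rfl
    · rw [liftTile]; split_ifs
      · exact hf1 _
      · exact zero_le_one
    · refine (Finset.sum_le_sum fun g _ => mul_le_mul_of_nonneg_left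
        (tsum_liftTile_off_tileCut_le hR g.1 hf) ENNReal.toReal_nonneg).trans ?_
      simp_rw [mul_left_comm _ (hR.toFinset.card : ℝ)]
      rw [← Finset.mul_sum]
      refine (mul_le_mul_of_nonneg_left hfE (Nat.cast_nonneg _)).trans ?_
      rw [← hK, mul_div_assoc', div_le_iff₀ (by positivity)]
      nlinarith

theorem mainTheorem3 {X : Type*} [Countable X] [Infinite X]
    (G : Subgroup (TreeAut X))
    (S : Set G) (hSfin : S.Finite) (hS : Subgroup.closure S = ⊤)
    (hbdd : ∀ g ∈ G, g.HasBoundedActivity)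
    (hlevel : ∀ n : ℕ, IsRecurrentAction G (TreeLevel X n))
    (C : (schreierGraph S (TreeEnds X)).ConnectedComponent) :
    IsRecurrentAction G (schreierComponent S hS C) := by
  have : Countable G := countable_of_closure_finite hSfin hS
  intro μ hμ hsym y
  exact (isRecurrentWalk_subMulAction_iff _ μ y).2
    (isRecurrentAction_treeEnds G hbdd hlevel μ hμ hsym y)
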